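/- Consider a network with finitely many sources $s_i$, routes $r_j$ and links $l_k$. Every route $r_j$ belongs to a unique source (written $s_i\sim r_j$) and uses a nonempty set of links (written $l_k\sim r_j$), and every link $l_k$ has a capacity $C_k\ge 0$. Let $A$ be the matrix with $A_{kj}=1$ if $l_k\sim r_j$ and $A_{kj}=0$ otherwise. Let the utilities $U_i:[0,\infty)\to\mathbb{R}$ be $C^2$, strictly concave and strictly increasing, and let $\kappa_j>0$ be arbitrary constants. The network problem is $$\max_{x\ge 0,\ Ax\le C}\ \sum_i U_i\Big(\sum_{r_j\sim s_i}x_j\Big),$$ with Lagrangian $\varphi(x,y)=\sum_i U_i\big(\sum_{r_j\sim s_i}x_j\big)+y^T(C-Ax)$ for $x\ge 0$, $y\ge 0$. For $b\ge 0$ write $[a]^+_b=a$ if $b>0$ and $[a]^+_b=\max(a,0)$ if $b=0$. The modified dynamics with auxiliary variables $x'$ are $$\dot x_j=\Big[U_i'\Big(\sum_{r_k\sim s_i}x_k\Big)-\sum_{l_k\sim r_j}y_k+\kappa_j(x'_j-x_j)\Big]^+_{x_j}\ (s_i\sim r_j),\qquad \dot x'_j=\kappa_j(x_j-x'_j),\qquad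 \dot y_k=\Big[\sum_{r_j\sim l_k}x_j-C_k\Big]^+_{y_k},$$ where $U_i'$ is one-sided at $0$. Then every Carathéodory solution $(x(t),x'(t),y(t))$, $t\ge 0$, of these dynamics with $x(t)\ge 0$, $y(t)\ge 0$ (components absolutely continuous on each $[0,T]$, equations satisfied for almost every $t$) converges as $t\to\infty$ to a maximizer of the network problem: there are a maximizer $x^*$ and a vector $y^*$ such that $(x^*,y^*)$ is a saddle point of $\varphi$ on $\{x\ge 0,\,y\ge 0\}$ (that is, $\varphi(x,y^*)\le\varphi(x^*,y^*)\le\varphi(x^*,y)$ for all $x\ge 0$, $y\ge 0$) and $x(t)\to x^*$, $x'(t)\to x^*$, $y(t)\to y^*$. -/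

import Mathlib

open Set Filter Topology MeasureTheory

/-- A network with sources `S`, routes `R` and links `L`: every route `j` has a unique source
`source j` and uses the set `links j` of links; the link `k` has capacity `capacity k`. -/
structure RoutingNetwork (S R L : Type*) where
  source : R → S
  links : R → Finset L
  capacity : L → ℝ

/-- `(x₀, y₀)` is a `K`-restricted saddle point of `φ` (a maximum in the first variable, a minimum
in the second one, among points of `K`). -/
def IsRestrictedSaddlePoint {X Y : Type*} (K : Set (X × Y)) (φ : X → Y → ℝ) (x₀ : X) (y₀ : Y) :
    Prop :=
  (x₀, y₀) ∈ K ∧ (∀ x, (x, y₀) ∈ K → φ x y₀ ≤ φ x₀ y₀) ∧ (∀ y, (x₀, y) ∈ K → φ x₀ y₀ ≤ φ x₀ y)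

/-- The projection `[a]⁺_b` of a rate of change `a` of a nonnegative quantity with current
value `b`: it is `a` if `b > 0` and `max a 0` if `b = 0`. -/
noncomputable def projRate (a b : ℝ) : ℝ := if 0 < b then a else max a 0

namespace RoutingNetwork

variable {S R L : Type*} [Fintype S] [Fintype R] [Fintype L] [DecidableEq S] [DecidableEq L]

/-- Total usage `∑_{r_j ∼ s_i} x_j` of the routes of the source `i`. -/
def sourceFlow (N : RoutingNetwork S R L) (x : R → ℝ) (i : S) : ℝ :=
  ∑ j with N.source j = i, x j

/-- Total usage `(A x)_k = ∑_{r_j ∼ l_k} x_j` of the link `k`. -/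
def linkFlow (N : RoutingNetwork S R L) (x : R → ℝ) (k : L) : ℝ :=
  ∑ j with k ∈ N.links j, x j

/-- Congestion price `(Aᵀ y)_j = ∑_{l_k ∼ r_j} y_k` of the route `j`. -/
def routePrice (N : RoutingNetwork S R L) (y : L → ℝ) (j : R) : ℝ :=
  ∑ k ∈ N.links j, y k

/-- The aggregate utility `∑_i U_i (∑_{r_j ∼ s_i} x_j)`. -/
def totalUtility (N : RoutingNetwork S R L) (U : S → ℝ → ℝ) (x : R → ℝ) : ℝ :=
  ∑ i, U i (N.sourceFlow x i)

/-- The constraint set `x ≥ 0`, `A x ≤ C`. -/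
def feasibleSet (N : RoutingNetwork S R L) : Set (R → ℝ) :=
  {x | (∀ j, 0 ≤ x j) ∧ ∀ k, N.linkFlow x k ≤ N.capacity k}

/-- `x` solves the network problem: maximise the aggregate utility over the constraint set. -/
def IsOptimal (N : RoutingNetwork S R L) (U : S → ℝ → ℝ) (x : R → ℝ) : Prop :=
  x ∈ N.feasibleSet ∧ IsMaxOn (N.totalUtility U) N.feasibleSet x

/-- The Lagrangian `φ(x, y) = ∑_i U_i (∑_{r_j ∼ s_i} x_j) + yᵀ (C - A x)`. -/
def lagrangian (N : RoutingNetwork S R L) (U : S → ℝ → ℝ) (x : R → ℝ) (y : L → ℝ) : ℝ :=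
  N.totalUtility U x + ∑ k, y k * (N.capacity k - N.linkFlow x k)

/-- The positive orthant `x ≥ 0`, `y ≥ 0`. -/
def orthant (R L : Type*) : Set ((R → ℝ) × (L → ℝ)) :=
  {z | (∀ j, 0 ≤ z.1 j) ∧ ∀ k, 0 ≤ z.2 k}

/-- `(x, x', y)` is a Carathéodory solution on `[0, ∞)` of the modified dynamics
* `ẋ_j = [U_i'(∑_{s_i ∼ r_k} x_k) - ∑_{l_k ∼ r_j} y_k + κ_j (x'_j - x_j)]⁺_{x_j}`, where `s_i ∼ r_j`,
* `ẋ'_j = κ_j (x_j - x'_j)`,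
* `ẏ_k = [∑_{l_k ∼ r_j} x_j - C_k]⁺_{y_k}`

in the domain `x ≥ 0`, `x' ∈ ℝ^R`, `y ≥ 0`: the components are absolutely continuous on every
interval `[0, T]`, and the equations hold at almost every time. The derivative of `U i`, a function
on `[0, ∞)`, is one-sided at `0`. -/
structure IsModifiedSolution (N : RoutingNetwork S R L) (U : S → ℝ → ℝ) (κ : R → ℝ)
    (x x' : ℝ → R → ℝ) (y : ℝ → L → ℝ) : Prop where
  mem_domain : ∀ t, 0 ≤ t → (x t, y t) ∈ orthant R L
  ac_x : ∀ j, ∀ T, 0 ≤ T → AbsolutelyContinuousOnInterval (fun t => x t j) 0 T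
  ac_x' : ∀ j, ∀ T, 0 ≤ T → AbsolutelyContinuousOnInterval (fun t => x' t j) 0 T
  ac_y : ∀ k, ∀ T, 0 ≤ T → AbsolutelyContinuousOnInterval (fun t => y t k) 0 T
  ode_x : ∀ j, ∀ᵐ t, 0 < t → HasDerivAt (fun s => x s j)
    (projRate (derivWithin (U (N.source j)) (Ici 0) (N.sourceFlow (x t) (N.source j))
      - N.routePrice (y t) j + κ j * (x' t j - x t j)) (x t j)) t
  ode_x' : ∀ j, ∀ᵐ t, 0 < t → HasDerivAt (fun s => x' s j) (κ j * (x t j - x' t j)) t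
  ode_y : ∀ k, ∀ᵐ t, 0 < t → HasDerivAt (fun s => y s k)
    (projRate (N.linkFlow (x t) k - N.capacity k) (y t k)) t

end RoutingNetwork

/-! Fix a KKT point `(xs, ys)` and let `energy` be the squared distance from the state `(x, x', y)`
to `(xs, xs, ys)`. Projection onto the orthant never increases this distance, and concavity with the
saddle inequalities cancels every term except the damping: `IsKKT.dissipation` gives energy
derivative at most `-2 ∑ κ_j (x_j - x'_j)^2`. Hence solutions are bounded, `x - x'` is Lipschitz,
and a Barbalat argument (`tendsto_zero_of_sq_le_decay`) yields `x - x' → 0`. The damping is needed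
because the aggregate utility need not be strictly concave in the individual routes.

A LaSalle argument identifies the limits. Along an ultrafilter finer than `atTop`, `x'` and `y`
converge. Since `x'` moves ever more slowly, `x'` and `x` converge uniformly on time windows `t +
[-T, T]`, hence so do the link flows and then `y`. A projected flow whose state and rate are
asymptotically constant on windows is complementary, so the limit is a KKT point
(`isKKT_of_tendsto`). The energy relative to this limit is antitone and tends to `0` along the
ultrafilter, hence along `atTop`. Existence of the initial KKT point comes from Sion's minimax
theorem on a large box (`exists_isKKT`). -/

set_option linter.unusedSectionVars false

/-! ### Increment bounds for absolutely continuous functions -/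

namespace AbsolutelyContinuousOnInterval

theorem finset_sum {ι : Type*} (s : Finset ι) {f : ι → ℝ → ℝ} {a b : ℝ}
    (hf : ∀ i ∈ s, AbsolutelyContinuousOnInterval (f i) a b) :
    AbsolutelyContinuousOnInterval (fun t => ∑ i ∈ s, f i t) a b := by
  classical
  induction s using Finset.induction_on with
  | empty =>
    simpa using ((LipschitzWith.const (α := ℝ) (0 : ℝ)).lipschitzOnWith
      (s := uIcc a b)).absolutelyContinuousOnInterval
  | insert i s hi ih =>
    simp only [Finset.sum_insert hi]
    exact (hf i (by simp)).add (ih fun j hj => hf j (by simp [hj]))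

theorem sq_sub_const {f : ℝ → ℝ} {a b : ℝ} (hf : AbsolutelyContinuousOnInterval f a b) (c : ℝ) :
    AbsolutelyContinuousOnInterval (fun t => (f t - c) ^ 2) a b := by
  have h : AbsolutelyContinuousOnInterval (fun t => f t - c) a b :=
    hf.sub ((LipschitzWith.const (α := ℝ) c).lipschitzOnWith
      (s := uIcc a b)).absolutelyContinuousOnInterval
  simp only [pow_two]
  exact h.mul h

theorem sub_le_mul_of_ae {f : ℝ → ℝ} {a b c : ℝ} (hf : AbsolutelyContinuousOnInterval f a b)
    (hab : a ≤ b) (h : ∀ᵐ t, t ∈ Ioo a b → ∃ d, HasDerivAt f d t ∧ d ≤ c) :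
    f b - f a ≤ c * (b - a) := by
  rw [← hf.integral_deriv_eq_sub]
  have hc : ∫ _ in a..b, c = c * (b - a) := by simp [mul_comm]
  rw [← hc]
  refine intervalIntegral.integral_mono_ae_restrict hab hf.intervalIntegrable_deriv (by simp) ?_
  rw [← Measure.restrict_congr_set Ioo_ae_eq_Icc]
  refine (ae_restrict_iff' measurableSet_Ioo).2 ?_
  filter_upwards [h] with t ht hmem
  obtain ⟨d, hd, hdc⟩ := ht hmem
  rwa [hd.deriv]

theorem mul_le_sub_of_ae {f : ℝ → ℝ} {a b c : ℝ} (hf : AbsolutelyContinuousOnInterval f a b)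
    (hab : a ≤ b) (h : ∀ᵐ t, t ∈ Ioo a b → ∃ d, HasDerivAt f d t ∧ c ≤ d) :
    c * (b - a) ≤ f b - f a := by
  have := hf.neg.sub_le_mul_of_ae (c := -c) hab (by
    filter_upwards [h] with t ht hmem
    obtain ⟨d, hd, hdc⟩ := ht hmem
    exact ⟨-d, hd.neg, by linarith⟩)
  simp only [Pi.neg_apply] at this
  linarith

theorem abs_sub_le_of_ae {f : ℝ → ℝ} {a b c : ℝ} (hf : AbsolutelyContinuousOnInterval f a b)
    (hab : a ≤ b) (h : ∀ᵐ t, t ∈ Ioo a b → ∃ d, HasDerivAt f d t ∧ |d| ≤ c) :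
    |f b - f a| ≤ c * (b - a) := by
  rw [abs_le]
  constructor
  · have := hf.mul_le_sub_of_ae (c := -c) hab (by
      filter_upwards [h] with t ht hmem
      obtain ⟨d, hd, hdc⟩ := ht hmem
      exact ⟨d, hd, (abs_le.1 hdc).1⟩)
    linarith
  · refine hf.sub_le_mul_of_ae hab ?_
    filter_upwards [h] with t ht hmem
    obtain ⟨d, hd, hdc⟩ := ht hmem
    exact ⟨d, hd, (abs_le.1 hdc).2⟩

end AbsolutelyContinuousOnInterval

/-! ### Scalar projected flows and their limits on time windows -/

theorem le_projRate (a b : ℝ) : a ≤ projRate a b := by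
  unfold projRate; split_ifs <;> simp

theorem abs_projRate_le (a b : ℝ) : |projRate a b| ≤ |a| := by
  unfold projRate; split_ifs
  · rfl
  · rcases le_total a 0 with h | h <;> simp [h]

theorem projRate_of_pos {a b : ℝ} (hb : 0 < b) : projRate a b = a := if_pos hb

theorem projRate_nonpos {a : ℝ} (ha : a ≤ 0) (b : ℝ) : projRate a b ≤ 0 := by
  unfold projRate; split_ifs <;> simp [ha]

/-- The projection changes the rate only at `b = 0`, where it raises it, while the factor `b - c =
-c` is nonpositive. This lets the energy estimate discard the projections. -/
theorem sub_mul_projRate_le {a b c : ℝ} (hb : 0 ≤ b) (hc : 0 ≤ c) :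
    (b - c) * projRate a b ≤ (b - c) * a := by
  rcases hb.lt_or_eq with h | rfl
  · rw [projRate_of_pos h]
  · have := le_projRate a 0
    nlinarith

/-- A nonnegative projected flow with rate at most `-δ` reaches zero in time `f a / δ`. -/
theorem eq_zero_of_projected_decrease {f g : ℝ → ℝ} {a b δ : ℝ}
    (hf : AbsolutelyContinuousOnInterval f a b) (hab : a ≤ b) (hδ : 0 ≤ δ)
    (hnn : 0 ≤ f b) (hlt : f a < δ * (b - a))
    (hode : ∀ᵐ t, t ∈ Ioo a b → HasDerivAt f (projRate (g t) (f t)) t)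
    (hg : ∀ t ∈ Icc a b, g t ≤ -δ) : f b = 0 := by
  by_contra hne
  have hpos : 0 < f b := lt_of_le_of_ne hnn (Ne.symm hne)
  -- The rate is nonpositive, so `f` is antitone and positivity at `b` spreads back over `[a, b]`.
  -- There the projection is inactive and `f` would lose more than `f a`.
  have hp : ∀ s ∈ Icc a b, 0 < f s := by
    intro s hs
    have h1 := (hf.mono (c := s) (d := b) (by
      rw [uIcc_of_le hs.2, uIcc_of_le hab]; exact Icc_subset_Icc_left hs.1)).sub_le_mul_of_ae
        (c := 0) hs.2 (by
      filter_upwards [hode] with t ht hmem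
      have hm : t ∈ Ioo a b := ⟨hs.1.trans_lt hmem.1, hmem.2⟩
      exact ⟨_, ht hm, projRate_nonpos ((hg t (Ioo_subset_Icc_self hm)).trans (by linarith)) _⟩)
    linarith
  have h2 := hf.sub_le_mul_of_ae (c := -δ) hab (by
    filter_upwards [hode] with t ht hmem
    refine ⟨_, ht hmem, ?_⟩
    rw [projRate_of_pos (hp t (Ioo_subset_Icc_self hmem))]
    exact hg t (Ioo_subset_Icc_self hmem))
  linarith

/-- The limit of a projected flow whose state and rate converge, uniformly on time windows of
length one, is complementary. -/
theorem complementary_of_tendsto_window {F : Filter ℝ} [F.NeBot] (hF : F ≤ atTop) {f g : ℝ → ℝ}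
    {p q : ℝ} (hf : ∀ T, 0 ≤ T → AbsolutelyContinuousOnInterval f 0 T)
    (hode : ∀ᵐ t, 0 < t → HasDerivAt f (projRate (g t) (f t)) t)
    (hp : 0 ≤ p)
    (hfp : Tendsto (fun z : ℝ × ℝ => f (z.1 + z.2)) (F ×ˢ 𝓟 (Icc (-1) 1)) (𝓝 p))
    (hgq : Tendsto (fun z : ℝ × ℝ => g (z.1 + z.2)) (F ×ˢ 𝓟 (Icc (-1) 1)) (𝓝 q)) :
    q ≤ 0 ∧ p * q = 0 := by
  have key : ∀ ε > 0, ∃ t, 0 < t ∧ ∀ s ∈ Icc t (t + 1), |f s - p| < ε ∧ |g s - q| < ε := by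
    intro ε hε
    have h1 := eventually_prod_principal_iff.1 (hfp.eventually (Metric.ball_mem_nhds p hε))
    have h2 := eventually_prod_principal_iff.1 (hgq.eventually (Metric.ball_mem_nhds q hε))
    obtain ⟨t, ht0, ht1, ht2⟩ := (((eventually_gt_atTop (0 : ℝ)).filter_mono hF).and (h1.and h2)).exists
    refine ⟨t, ht0, fun s hs => ?_⟩
    have hm : s - t ∈ Icc (-1 : ℝ) 1 := ⟨by linarith [hs.1], by linarith [hs.2]⟩
    have a1 := ht1 (s - t) hm
    have a2 := ht2 (s - t) hm
    simp only [add_sub_cancel, Real.dist_eq] at a1 a2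
    exact ⟨a1, a2⟩
  have hac : ∀ t, 0 < t → AbsolutelyContinuousOnInterval f t (t + 1) := fun t ht =>
    (hf (t + 1) (by linarith)).mono (by
      rw [uIcc_of_le (by linarith), uIcc_of_le (by linarith)]
      exact Icc_subset_Icc_left ht.le)
  have hq : q ≤ 0 := by
    by_contra! hq
    -- Over unit time `f` would rise by at least `3q/4`, yet it stays within `q/4` of `p` and can
    -- change by less than `q/2`.
    obtain ⟨t, ht, h⟩ := key (q / 4) (by linarith)
    have h2 := (hac t ht).mul_le_sub_of_ae (c := 3 / 4 * q) (by linarith) (by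
      filter_upwards [hode] with s hs hmem
      refine ⟨_, hs (ht.trans hmem.1), le_trans ?_ (le_projRate _ _)⟩
      have := abs_lt.1 (h s (Ioo_subset_Icc_self hmem)).2
      linarith)
    have h3 := abs_lt.1 (h t ⟨le_rfl, by linarith⟩).1
    have h4 := abs_lt.1 (h (t + 1) ⟨by linarith, le_rfl⟩).1
    linarith
  refine ⟨hq, ?_⟩
  by_contra hne
  have hp' : 0 < p := lt_of_le_of_ne hp fun h => hne (by simp [← h])
  have hq' : q < 0 := lt_of_le_of_ne hq fun h => hne (by simp [h])
  -- Closeness `p` keeps `f` positive, so the projection is inactive; closeness `-q/4` gives the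
  -- same contradiction as above with signs reversed.
  obtain ⟨t, ht, h⟩ := key (min p (-q / 4)) (lt_min hp' (by linarith))
  have h2 := (hac t ht).sub_le_mul_of_ae (c := 3 / 4 * q) (by linarith) (by
    filter_upwards [hode] with s hs hmem
    refine ⟨_, hs (ht.trans hmem.1), ?_⟩
    have h5 := h s (Ioo_subset_Icc_self hmem)
    rw [projRate_of_pos]
    · have := abs_lt.1 (h5.2.trans_le (min_le_right _ _))
      linarith
    · have := abs_lt.1 (h5.1.trans_le (min_le_left _ _))
      linarith)
  have h3 := abs_lt.1 ((h t ⟨le_rfl, by linarith⟩).1.trans_le (min_le_right _ _))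
  have h4 := abs_lt.1 ((h (t + 1) ⟨by linarith, le_rfl⟩).1.trans_le (min_le_right _ _))
  linarith

/-- A bounded convergent projected flow whose rate converges uniformly on compact time windows
converges uniformly on compact time windows. -/
theorem tendsto_window_of_tendsto_rate {F : Filter ℝ} [F.NeBot] (hF : F ≤ atTop) {f g : ℝ → ℝ}
    {p q B : ℝ} (hf : ∀ T, 0 ≤ T → AbsolutelyContinuousOnInterval f 0 T)
    (hode : ∀ᵐ t, 0 < t → HasDerivAt f (projRate (g t) (f t)) t)
    (hnn : ∀ t, 0 ≤ t → 0 ≤ f t) (hB : ∀ t, 0 ≤ t → f t ≤ B)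
    (hfp : Tendsto f F (𝓝 p))
    (hgq : ∀ T, Tendsto (fun z : ℝ × ℝ => g (z.1 + z.2)) (F ×ˢ 𝓟 (Icc (-T) T)) (𝓝 q)) (T : ℝ) :
    Tendsto (fun z : ℝ × ℝ => f (z.1 + z.2)) (F ×ˢ 𝓟 (Icc (-T) T)) (𝓝 p) := by
  have key : ∀ T, ∀ ε > 0, ∀ᶠ t in F, ∀ s, |s - t| ≤ T → |g s - q| < ε := by
    intro T ε hε
    have h2 := eventually_prod_principal_iff.1 ((hgq T).eventually (Metric.ball_mem_nhds q hε))
    filter_upwards [h2] with t ht s hs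
    have := ht (s - t) (abs_le.1 hs)
    simpa only [add_sub_cancel, Metric.mem_ball, Real.dist_eq] using this
  have hac : ∀ a b, 0 ≤ a → a ≤ b → AbsolutelyContinuousOnInterval f a b := fun a b ha hab =>
    (hf b (ha.trans hab)).mono (by
      rw [uIcc_of_le hab, uIcc_of_le (ha.trans hab)]
      exact Icc_subset_Icc_left ha)
  have hB0 : 0 ≤ B := (hnn 0 le_rfl).trans (hB 0 le_rfl)
  rcases lt_or_ge T 0 with hT | hT
  · rw [Icc_eq_empty (by linarith)]; simp
  have hq : q ≤ 0 := by
    by_contra! hq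
    -- A rate of at least `q/2` kept up for time `τ` lifts `f` by `B + 1`, beyond its bound `B`.
    set τ := 2 * (B + 1) / q
    have hτ : 0 < τ := by positivity
    have hqτ : q / 2 * τ = B + 1 := by simp only [τ]; field_simp
    obtain ⟨t, ht0, ht⟩ := (((eventually_gt_atTop (0 : ℝ)).filter_mono hF).and (key τ (q / 2) (by linarith))).exists
    replace ht0 : 0 < t := ht0
    have h2 := (hac t (t + τ) ht0.le (by linarith)).mul_le_sub_of_ae (c := q / 2) (by linarith) (by
      filter_upwards [hode] with s hs hmem
      refine ⟨_, hs (ht0.trans hmem.1), le_trans ?_ (le_projRate _ _)⟩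
      have := abs_lt.1 (ht s (abs_le.2 ⟨by linarith [hmem.1], by linarith [hmem.2]⟩))
      linarith)
    have h3 := hB (t + τ) (by linarith)
    have h4 := hnn t ht0.le
    rw [add_sub_cancel_left, hqτ] at h2
    linarith
  rw [Metric.tendsto_nhds]
  intro ε hε
  rw [eventually_prod_principal_iff]
  rcases hq.lt_or_eq with hq | rfl
  -- Starting at `s - τ` from a value at most `B`, a rate at most `q/2` empties `f` by time `s`.
  -- Applied to every `s` in the window, this needs the rate on the larger window `T + τ`, whence
  -- `hgq` for all `T`.
  · set τ := 2 * (B + 1) / (-q)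
    have hnq : 0 < -q := by linarith
    have hτ : 0 < τ := by positivity
    have hqτ : (-q / 2) * τ = B + 1 := by
      have := hnq.ne'
      simp only [τ]
      generalize -q = r at *
      field_simp
    have hz : ∀ᶠ t in F, ∀ s, |s - t| ≤ T → f s = 0 := by
      filter_upwards [hF (Ioi_mem_atTop (T + τ)), key (T + τ) (-q / 2) (by linarith)]
        with t ht0 ht s hs
      replace ht0 : T + τ < t := ht0
      obtain ⟨hs1, hs2⟩ := abs_le.1 hs
      refine eq_zero_of_projected_decrease (f := f) (g := g) (a := s - τ) (δ := -q / 2)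
        (hac _ _ (by linarith) (by linarith)) (by linarith) (by linarith) (hnn s (by linarith))
        ?_ ?_ ?_
      · have := hB (s - τ) (by linarith)
        rw [sub_sub_cancel, hqτ]
        linarith
      · filter_upwards [hode] with u hu hmem
        exact hu (by linarith [hmem.1])
      · intro u hu
        have := abs_lt.1 (ht u (abs_le.2 ⟨by linarith [hu.1], by linarith [hu.2]⟩))
        linarith
    have hp : p = 0 := by
      refine tendsto_nhds_unique hfp (tendsto_const_nhds.congr' ?_)
      filter_upwards [hz] with t ht
      exact (ht t (by simpa using hT)).symm
    filter_upwards [hz] with t ht s hs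
    rw [ht (t + s) (by simpa using abs_le.2 hs), hp]
    simpa using hε
  -- With limiting rate `0`, `f` drifts by at most `ε/4` across the window; `T + 1` avoids dividing
  -- by zero when `T = 0`.
  · have hη : 0 < ε / (4 * (T + 1)) := by positivity
    filter_upwards [hF (Ioi_mem_atTop T), key T _ hη, Metric.tendsto_nhds.1 hfp (ε / 2) (by linarith)]
      with t ht0 ht hpt s hs
    replace ht0 : T < t := ht0
    have hbd : ∀ u v, u ≤ v → |u - t| ≤ T → |v - t| ≤ T → v - u ≤ T → |f v - f u| ≤ ε / 4 := by
      intro u v huv hu hv hT'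
      obtain ⟨hu1, hu2⟩ := abs_le.1 hu
      obtain ⟨hv1, hv2⟩ := abs_le.1 hv
      refine ((hac u v (by linarith) huv).abs_sub_le_of_ae (c := ε / (4 * (T + 1))) huv ?_).trans ?_
      · filter_upwards [hode] with w hw hmem
        refine ⟨_, hw (by linarith [hmem.1]), (abs_projRate_le _ _).trans ?_⟩
        have := (ht w (abs_le.2 ⟨by linarith [hmem.1], by linarith [hmem.2]⟩)).le
        simpa using this
      · have h1 : ε / (4 * (T + 1)) * (v - u) ≤ ε / (4 * (T + 1)) * (T + 1) := by
          gcongr; linarith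
        have h2 : ε / (4 * (T + 1)) * (T + 1) = ε / 4 := by field_simp
        linarith
    have hst : |f (t + s) - f t| ≤ ε / 4 := by
      rcases le_total 0 s with h | h
      · exact hbd t (t + s) (by linarith) (by simpa using hT)
          (by simpa using abs_le.2 hs) (by linarith [hs.2])
      · rw [abs_sub_comm]
        exact hbd (t + s) t (by linarith) (by simpa using abs_le.2 hs) (by simpa using hT)
          (by linarith [hs.1])
    calc dist (f (t + s)) p ≤ dist (f (t + s)) (f t) + dist (f t) p := dist_triangle _ _ _
      _ < ε := by rw [Real.dist_eq]; linarith

/-- A function whose derivative vanishes at infinity converges uniformly on compact time windows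
along every filter along which it converges. -/
theorem tendsto_window_of_tendsto_deriv_zero {F : Filter ℝ} (hF : F ≤ atTop) {f g : ℝ → ℝ}
    {p : ℝ} (hf : ∀ T, 0 ≤ T → AbsolutelyContinuousOnInterval f 0 T)
    (hode : ∀ᵐ t, 0 < t → HasDerivAt f (g t) t)
    (hg : Tendsto g atTop (𝓝 0)) (hfp : Tendsto f F (𝓝 p)) (T : ℝ) :
    Tendsto (fun z : ℝ × ℝ => f (z.1 + z.2)) (F ×ˢ 𝓟 (Icc (-T) T)) (𝓝 p) := by
  rcases lt_or_ge T 0 with hT | hT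
  · rw [Icc_eq_empty (by linarith)]; simp
  rw [Metric.tendsto_nhds]
  intro ε hε
  rw [eventually_prod_principal_iff]
  have hη : 0 < ε / (4 * (T + 1)) := by positivity
  obtain ⟨t₀, ht₀⟩ := eventually_atTop.1 (Metric.tendsto_nhds.1 hg _ hη)
  filter_upwards [hF (Ioi_mem_atTop (max T (t₀ + T))), Metric.tendsto_nhds.1 hfp (ε / 2) (by linarith)]
    with t ht hpt s hs
  obtain ⟨h1, h2⟩ := max_lt_iff.1 (show max T (t₀ + T) < t from ht)
  have hbd : ∀ u v, u ≤ v → t - T ≤ u → v - u ≤ T → |f v - f u| ≤ ε / 4 := by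
    intro u v huv hu hv
    refine (((hf v (by linarith)).mono (c := u) (d := v) ?_).abs_sub_le_of_ae
      (c := ε / (4 * (T + 1))) huv ?_).trans ?_
    · rw [uIcc_of_le huv, uIcc_of_le (by linarith)]
      exact Icc_subset_Icc_left (by linarith)
    · filter_upwards [hode] with w hw hmem
      refine ⟨_, hw (by linarith [hmem.1]), ?_⟩
      simpa using (ht₀ w (by linarith [hmem.1])).le
    · have h1 : ε / (4 * (T + 1)) * (v - u) ≤ ε / (4 * (T + 1)) * (T + 1) := by
        gcongr; linarith
      have h2 : ε / (4 * (T + 1)) * (T + 1) = ε / 4 := by field_simp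
      linarith
  have hst : |f (t + s) - f t| ≤ ε / 4 := by
    rcases le_total 0 s with h | h
    · exact hbd t (t + s) (by linarith) (by linarith) (by linarith [hs.2])
    · rw [abs_sub_comm]
      exact hbd (t + s) t (by linarith) (by linarith [hs.1]) (by linarith [hs.1])
  calc dist (f (t + s)) p ≤ dist (f (t + s)) (f t) + dist (f t) p := dist_triangle _ _ _
    _ < ε := by rw [Real.dist_eq]; linarith

/-! ### One-sided optimality and tangent inequalities -/

theorem HasDerivWithinAt.nonpos_of_isMaxOn_Icc {f : ℝ → ℝ} {d q b : ℝ} (hqb : q < b)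
    (hd : HasDerivWithinAt f d (Icc q b) q) (hmax : IsMaxOn f (Icc q b) q) : d ≤ 0 := by
  rw [hasDerivWithinAt_iff_tendsto_slope, Icc_sdiff_left] at hd
  have : (𝓝[Ioc q b] q).NeBot := left_nhdsWithin_Ioc_neBot hqb
  refine le_of_tendsto hd ?_
  filter_upwards [self_mem_nhdsWithin] with s hs
  rw [slope_def_field]
  have := hmax (Ioc_subset_Icc_self hs)
  exact div_nonpos_of_nonpos_of_nonneg (sub_nonpos.2 this) (by linarith [hs.1])

theorem HasDerivWithinAt.nonneg_of_isMaxOn_Icc {f : ℝ → ℝ} {d q a : ℝ} (haq : a < q)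
    (hd : HasDerivWithinAt f d (Icc a q) q) (hmax : IsMaxOn f (Icc a q) q) : 0 ≤ d := by
  rw [hasDerivWithinAt_iff_tendsto_slope, Icc_sdiff_right] at hd
  have : (𝓝[Ico a q] q).NeBot := right_nhdsWithin_Ico_neBot haq
  refine ge_of_tendsto hd ?_
  filter_upwards [self_mem_nhdsWithin] with s hs
  rw [slope_def_field]
  have := hmax (Ico_subset_Icc_self hs)
  exact div_nonneg_of_nonpos (sub_nonpos.2 this) (by linarith [hs.2])

theorem ConcaveOn.sub_le_derivWithin_mul {f : ℝ → ℝ} {s : Set ℝ} (hf : ConcaveOn ℝ s f)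
    (hd : DifferentiableOn ℝ f s) {a b : ℝ} (ha : a ∈ s) (hb : b ∈ s) :
    f b - f a ≤ derivWithin f s a * (b - a) := by
  rcases lt_trichotomy a b with h | rfl | h
  · have := hf.slope_le_derivWithin ha hb h (hd a ha)
    rwa [slope_def_field, div_le_iff₀ (by linarith)] at this
  · simp
  · have := hf.derivWithin_le_slope hb ha h (hd a ha)
    rw [slope_def_field, le_div_iff₀ (by linarith)] at this
    linarith

/-! ### KKT conditions and saddle points of the Lagrangian -/

namespace RoutingNetwork

variable {S R L : Type*} [Fintype S] [Fintype R] [Fintype L] [DecidableEq S] [DecidableEq L]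

theorem sourceFlow_sub (N : RoutingNetwork S R L) (x z : R → ℝ) (i : S) :
    N.sourceFlow (fun j => x j - z j) i = N.sourceFlow x i - N.sourceFlow z i :=
  Finset.sum_sub_distrib ..

theorem linkFlow_sub (N : RoutingNetwork S R L) (x z : R → ℝ) (k : L) :
    N.linkFlow (fun j => x j - z j) k = N.linkFlow x k - N.linkFlow z k :=
  Finset.sum_sub_distrib ..

theorem sourceFlow_nonneg (N : RoutingNetwork S R L) {x : R → ℝ} (hx : ∀ j, 0 ≤ x j) (i : S) :
    0 ≤ N.sourceFlow x i :=
  Finset.sum_nonneg fun j _ => hx j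

theorem le_sourceFlow (N : RoutingNetwork S R L) {x : R → ℝ} (hx : ∀ j, 0 ≤ x j) (j : R) :
    x j ≤ N.sourceFlow x (N.source j) :=
  Finset.single_le_sum (fun j _ => hx j) (by simp)

theorem le_linkFlow (N : RoutingNetwork S R L) {x : R → ℝ} (hx : ∀ j, 0 ≤ x j) {j : R} {k : L}
    (hk : k ∈ N.links j) : x j ≤ N.linkFlow x k :=
  Finset.single_le_sum (fun j _ => hx j) (by simpa using hk)

theorem le_routePrice (N : RoutingNetwork S R L) {y : L → ℝ} (hy : ∀ k, 0 ≤ y k) {j : R} {k : L}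
    (hk : k ∈ N.links j) : y k ≤ N.routePrice y j :=
  Finset.single_le_sum (fun k _ => hy k) hk

theorem sum_mul_sourceFlow (N : RoutingNetwork S R L) (g : S → ℝ) (v : R → ℝ) :
    ∑ i, g i * N.sourceFlow v i = ∑ j, g (N.source j) * v j := by
  rw [← Finset.sum_fiberwise Finset.univ N.source]
  refine Finset.sum_congr rfl fun i _ => ?_
  rw [sourceFlow, Finset.mul_sum]
  refine Finset.sum_congr rfl fun j hj => ?_
  rw [(Finset.mem_filter.1 hj).2]

theorem sum_routePrice_mul (N : RoutingNetwork S R L) (y : L → ℝ) (v : R → ℝ) :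
    ∑ j, N.routePrice y j * v j = ∑ k, y k * N.linkFlow v k := by
  simp only [routePrice, linkFlow, Finset.sum_mul, Finset.mul_sum]
  exact Finset.sum_comm' (by simp)

/-- The marginal profit `U_i'(∑_{r_k ∼ s_i} x_k) - ∑_{l_k ∼ r_j} y_k` of the route `j`, where
`s_i ∼ r_j`. -/
noncomputable def marginal (N : RoutingNetwork S R L) (U : S → ℝ → ℝ) (x : R → ℝ) (y : L → ℝ)
    (j : R) : ℝ :=
  derivWithin (U (N.source j)) (Ici 0) (N.sourceFlow x (N.source j)) - N.routePrice y j

/-- The Karush-Kuhn-Tucker conditions of the network problem. -/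
structure IsKKT (N : RoutingNetwork S R L) (U : S → ℝ → ℝ) (x : R → ℝ) (y : L → ℝ) : Prop where
  nonneg_x : ∀ j, 0 ≤ x j
  nonneg_y : ∀ k, 0 ≤ y k
  marginal_nonpos : ∀ j, N.marginal U x y j ≤ 0
  mul_marginal : ∀ j, x j * N.marginal U x y j = 0
  flow_le : ∀ k, N.linkFlow x k - N.capacity k ≤ 0
  mul_flow : ∀ k, y k * (N.linkFlow x k - N.capacity k) = 0

theorem sum_marginal_mul (N : RoutingNetwork S R L) (U : S → ℝ → ℝ) (x : R → ℝ) (y : L → ℝ)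
    (v : R → ℝ) :
    ∑ j, N.marginal U x y j * v j =
      ∑ i, derivWithin (U i) (Ici 0) (N.sourceFlow x i) * N.sourceFlow v i
        - ∑ k, y k * N.linkFlow v k := by
  rw [N.sum_mul_sourceFlow (fun i => derivWithin (U i) (Ici 0) (N.sourceFlow x i)),
    ← N.sum_routePrice_mul, ← Finset.sum_sub_distrib]
  exact Finset.sum_congr rfl fun j _ => by rw [marginal, sub_mul]

/-- `marginal` is the gradient of the Lagrangian in `x`: concavity bounds each utility by its
tangent line, and the price terms are affine. -/
theorem lagrangian_sub_le {N : RoutingNetwork S R L} {U : S → ℝ → ℝ}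
    (hc : ∀ i, ConcaveOn ℝ (Ici 0) (U i)) (hd : ∀ i, DifferentiableOn ℝ (U i) (Ici 0))
    {x z : R → ℝ} (hx : ∀ j, 0 ≤ x j) (hz : ∀ j, 0 ≤ z j) (y : L → ℝ) :
    N.lagrangian U z y - N.lagrangian U x y ≤ ∑ j, N.marginal U x y j * (z j - x j) := by
  rw [N.sum_marginal_mul U x y fun j => z j - x j]
  have h1 : N.totalUtility U z - N.totalUtility U x ≤
      ∑ i, derivWithin (U i) (Ici 0) (N.sourceFlow x i) * N.sourceFlow (fun j => z j - x j) i := by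
    rw [totalUtility, totalUtility, ← Finset.sum_sub_distrib]
    refine Finset.sum_le_sum fun i _ => ?_
    rw [sourceFlow_sub]
    exact (hc i).sub_le_derivWithin_mul (hd i) (N.sourceFlow_nonneg hx i) (N.sourceFlow_nonneg hz i)
  have h2 : ∑ k, y k * (N.capacity k - N.linkFlow z k)
      - ∑ k, y k * (N.capacity k - N.linkFlow x k)
      = - ∑ k, y k * N.linkFlow (fun j => z j - x j) k := by
    rw [← Finset.sum_sub_distrib, ← Finset.sum_neg_distrib]
    refine Finset.sum_congr rfl fun k _ => ?_
    rw [linkFlow_sub]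
    ring
  simp only [lagrangian]
  linarith

namespace IsKKT

variable {N : RoutingNetwork S R L} {U : S → ℝ → ℝ} {x : R → ℝ} {y : L → ℝ}

theorem isRestrictedSaddlePoint (h : N.IsKKT U x y) (hc : ∀ i, ConcaveOn ℝ (Ici 0) (U i))
    (hd : ∀ i, DifferentiableOn ℝ (U i) (Ici 0)) :
    IsRestrictedSaddlePoint (orthant R L) (N.lagrangian U) x y := by
  refine ⟨⟨h.nonneg_x, h.nonneg_y⟩, fun z hz => ?_, fun w hw => ?_⟩
  · have h1 := lagrangian_sub_le hc hd h.nonneg_x hz.1 y (N := N)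
    have h2 : ∑ j, N.marginal U x y j * (z j - x j) ≤ 0 := by
      refine Finset.sum_nonpos fun j _ => ?_
      have := mul_nonpos_of_nonpos_of_nonneg (h.marginal_nonpos j) (hz.1 j)
      have := h.mul_marginal j
      dsimp only at *
      linarith
    linarith
  · simp only [lagrangian]
    gcongr 1 with k
    refine Finset.sum_le_sum fun k _ => ?_
    have := mul_nonpos_of_nonneg_of_nonpos (hw.2 k) (h.flow_le k)
    have := h.mul_flow k
    dsimp only at *
    linarith

theorem isOptimal (h : N.IsKKT U x y) (hc : ∀ i, ConcaveOn ℝ (Ici 0) (U i))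
    (hd : ∀ i, DifferentiableOn ℝ (U i) (Ici 0)) : N.IsOptimal U x := by
  refine ⟨⟨h.nonneg_x, fun k => sub_nonpos.1 (h.flow_le k)⟩, fun z hz => ?_⟩
  have h1 := (h.isRestrictedSaddlePoint hc hd).2.1 z ⟨hz.1, h.nonneg_y⟩
  have h2 : ∑ k, y k * (N.capacity k - N.linkFlow x k) = 0 :=
    Finset.sum_eq_zero fun k _ => by linarith [h.mul_flow k]
  have h3 : 0 ≤ ∑ k, y k * (N.capacity k - N.linkFlow z k) :=
    Finset.sum_nonneg fun k _ => mul_nonneg (h.nonneg_y k) (sub_nonneg.2 (hz.2 k))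
  simp only [lagrangian] at h1
  show N.totalUtility U z ≤ N.totalUtility U x
  linarith

end IsKKT

/-! ### Existence of a KKT point -/

theorem continuous_sourceFlow (N : RoutingNetwork S R L) (i : S) :
    Continuous fun x => N.sourceFlow x i := by
  unfold sourceFlow; fun_prop

theorem continuous_linkFlow (N : RoutingNetwork S R L) (k : L) :
    Continuous fun x => N.linkFlow x k := by
  unfold linkFlow; fun_prop

theorem sourceFlow_add_single (N : RoutingNetwork S R L) [DecidableEq R] (x : R → ℝ) (j : R)
    (s : ℝ) (i : S) :
    N.sourceFlow (x + s • Pi.single j 1) i =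
      N.sourceFlow x i + if N.source j = i then s else 0 := by
  simp only [sourceFlow, Pi.add_apply, Pi.smul_apply, Finset.sum_add_distrib, smul_eq_mul,
    ← Finset.mul_sum]
  simp

theorem linkFlow_add_single (N : RoutingNetwork S R L) [DecidableEq R] (x : R → ℝ) (j : R)
    (s : ℝ) (k : L) :
    N.linkFlow (x + s • Pi.single j 1) k = N.linkFlow x k + if k ∈ N.links j then s else 0 := by
  simp only [linkFlow, Pi.add_apply, Pi.smul_apply, Finset.sum_add_distrib, smul_eq_mul,
    ← Finset.mul_sum]
  simp

/-- The Lagrangian along a coordinate line. -/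
theorem lagrangian_add_single (N : RoutingNetwork S R L) [DecidableEq R] (U : S → ℝ → ℝ)
    (x : R → ℝ) (y : L → ℝ) (j : R) (s : ℝ) :
    N.lagrangian U (x + s • Pi.single j 1) y - N.lagrangian U x y =
      U (N.source j) (N.sourceFlow x (N.source j) + s) - U (N.source j) (N.sourceFlow x (N.source j))
        - N.routePrice y j * s := by
  have h1 : N.totalUtility U (x + s • Pi.single j 1) - N.totalUtility U x =
      U (N.source j) (N.sourceFlow x (N.source j) + s)
        - U (N.source j) (N.sourceFlow x (N.source j)) := by
    rw [totalUtility, totalUtility, ← Finset.sum_sub_distrib, Finset.sum_eq_single (N.source j)]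
    · rw [sourceFlow_add_single, if_pos rfl]
    · intro i _ hi
      rw [sourceFlow_add_single, if_neg hi.symm, add_zero, sub_self]
    · simp
  have h2 : ∑ k, y k * (N.capacity k - N.linkFlow (x + s • Pi.single j 1) k)
      - ∑ k, y k * (N.capacity k - N.linkFlow x k) = - (N.routePrice y j * s) := by
    rw [← Finset.sum_sub_distrib, routePrice, Finset.sum_mul, ← Finset.sum_neg_distrib,
      ← Finset.sum_subset (Finset.subset_univ (N.links j))]
    · refine Finset.sum_congr rfl fun k hk => ?_
      rw [linkFlow_add_single, if_pos hk]; ring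
    · intro k _ hk
      rw [linkFlow_add_single, if_neg hk]; ring
  simp only [lagrangian]
  linarith

theorem concaveOn_lagrangian (N : RoutingNetwork S R L) {U : S → ℝ → ℝ}
    (hc : ∀ i, ConcaveOn ℝ (Ici 0) (U i)) (y : L → ℝ) :
    ConcaveOn ℝ {x : R → ℝ | ∀ j, 0 ≤ x j} (fun x => N.lagrangian U x y) := by
  have hs : Convex ℝ {x : R → ℝ | ∀ j, 0 ≤ x j} := convex_Ici (𝕜 := ℝ) (0 : R → ℝ)
  have hl : ∀ (i : S) (x z : R → ℝ) (a b : ℝ),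
      N.sourceFlow (a • x + b • z) i = a • N.sourceFlow x i + b • N.sourceFlow z i := by
    intro i x z a b
    simp [sourceFlow, Finset.sum_add_distrib, Finset.mul_sum]
  have hl' : ∀ (k : L) (x z : R → ℝ) (a b : ℝ),
      N.linkFlow (a • x + b • z) k = a * N.linkFlow x k + b * N.linkFlow z k := by
    intro i x z a b
    simp [linkFlow, Finset.sum_add_distrib, Finset.mul_sum]
  refine ConcaveOn.add ⟨hs, fun x hx z hz a b ha hb hab => ?_⟩
    ⟨hs, fun x hx z hz a b ha hb hab => le_of_eq ?_⟩
  · simp only [totalUtility, Finset.smul_sum, ← Finset.sum_add_distrib]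
    refine Finset.sum_le_sum fun i _ => ?_
    rw [hl]
    exact (hc i).2 (N.sourceFlow_nonneg hx i) (N.sourceFlow_nonneg hz i) ha hb hab
  · simp only [Finset.smul_sum, ← Finset.sum_add_distrib]
    refine Finset.sum_congr rfl fun k _ => ?_
    rw [hl', smul_eq_mul, smul_eq_mul]
    linear_combination (y k * N.capacity k) * hab

theorem continuousOn_lagrangian (N : RoutingNetwork S R L) {U : S → ℝ → ℝ}
    (hd : ∀ i, ContinuousOn (U i) (Ici 0)) (y : L → ℝ) :
    ContinuousOn (fun x => N.lagrangian U x y) {x : R → ℝ | ∀ j, 0 ≤ x j} := by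
  refine ContinuousOn.add (continuousOn_finsetSum _ fun i _ => ?_)
    (Continuous.continuousOn ?_)
  · exact (hd i).comp (N.continuous_sourceFlow i).continuousOn
      fun x hx => N.sourceFlow_nonneg hx i
  · exact continuous_finsetSum _ fun k _ =>
      continuous_const.mul (continuous_const.sub (N.continuous_linkFlow k))

/-- Sion's theorem gives a saddle point on a compact box whose side `B` exceeds every capacity and
whose price ceiling `M` exceeds every marginal utility. Neither artificial bound distorts the KKT
conditions: a price at the ceiling makes its routes unprofitable, and a feasible flow stays strictly
below `B`. -/
theorem exists_isKKT (N : RoutingNetwork S R L) (hC : ∀ k, 0 ≤ N.capacity k)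
    (hlinks : ∀ j, (N.links j).Nonempty) {U : S → ℝ → ℝ}
    (hc : ∀ i, ConcaveOn ℝ (Ici 0) (U i)) (hd : ∀ i, DifferentiableOn ℝ (U i) (Ici 0)) :
    ∃ x y, N.IsKKT U x y := by
  classical
  obtain ⟨B, hB⟩ : ∃ B, ∀ k, N.capacity k < B := by
    obtain ⟨B, hB⟩ := (Set.finite_range N.capacity).bddAbove
    exact ⟨B + 1, fun k => by linarith [hB (mem_range_self k)]⟩
  obtain ⟨M, hM0, hM⟩ : ∃ M, 0 ≤ M ∧ ∀ i, derivWithin (U i) (Ici 0) 0 < M := by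
    obtain ⟨M, hM⟩ := (Set.finite_range fun i => derivWithin (U i) (Ici 0) 0).bddAbove
    exact ⟨max 0 (M + 1), le_max_left _ _, fun i =>
      lt_max_of_lt_right (by linarith [hM (mem_range_self i)])⟩
  have hanti : ∀ (i : S) (q : ℝ), 0 ≤ q → derivWithin (U i) (Ici 0) q < M := fun i q hq =>
    ((hc i).antitoneOn_derivWithin (hd i) self_mem_Ici hq hq).trans_lt (hM i)
  -- The maximum with `0` matters only for empty `L`, where `B` could be negative and the box empty.
  have hsub : Icc (0 : R → ℝ) (fun _ => max B 0) ⊆ {x | ∀ j, 0 ≤ x j} := fun x hx => hx.1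
  obtain ⟨y, hy, x, hx, hxy⟩ := Sion.exists_isSaddlePointOn
    (X := Icc (0 : L → ℝ) (fun _ => M)) (Y := Icc (0 : R → ℝ) (fun _ => max B 0))
    (f := fun y x => N.lagrangian U x y)
    ⟨0, le_rfl, fun _ => hM0⟩ (convex_Icc _ _) isCompact_Icc
    (fun x _ => (Continuous.continuousOn (by
      unfold lagrangian; fun_prop)).lowerSemicontinuousOn)
    (fun x _ => by
      refine ConvexOn.quasiconvexOn ⟨convex_Icc _ _, fun y _ z _ a b ha hb hab => le_of_eq ?_⟩
      simp only [lagrangian, smul_eq_mul, Pi.add_apply, Pi.smul_apply, add_mul, mul_add,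
        Finset.mul_sum, Finset.sum_add_distrib, mul_assoc]
      linear_combination (-N.totalUtility U x) * hab)
    (convex_Icc _ _) ⟨0, le_rfl, fun _ => le_max_right _ _⟩ isCompact_Icc
    (fun y _ => ((N.continuousOn_lagrangian (fun i => (hd i).continuousOn) y).mono
      hsub).upperSemicontinuousOn)
    (fun y _ => ((N.concaveOn_lagrangian hc y).subset hsub (convex_Icc _ _)).quasiconcaveOn)
  have hx0 : ∀ j, 0 ≤ x j := fun j => hx.1 j
  have hy0 : ∀ k, 0 ≤ y k := fun k => hy.1 k
  have hq0 := N.sourceFlow_nonneg hx0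
  have hderiv : ∀ j, ∀ A ⊆ Ici (0 : ℝ), HasDerivWithinAt
      (fun s => U (N.source j) s - N.routePrice y j * (s - N.sourceFlow x (N.source j)))
      (N.marginal U x y j) A (N.sourceFlow x (N.source j)) := by
    intro j A hA
    have h1 := ((hd (N.source j)) _ (hq0 (N.source j))).hasDerivWithinAt.mono hA
    have h2 := (((hasDerivAt_id (N.sourceFlow x (N.source j))).sub_const
      (N.sourceFlow x (N.source j))).const_mul (N.routePrice y j)).hasDerivWithinAt (s := A)
    rw [mul_one] at h2
    exact h1.sub h2
  have hmax : ∀ j s, 0 ≤ x j + s → x j + s ≤ max B 0 →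
      U (N.source j) (N.sourceFlow x (N.source j) + s) - N.routePrice y j * s ≤
        U (N.source j) (N.sourceFlow x (N.source j)) := by
    intro j s h0 h1
    have h2 := hxy y hy (x + s • Pi.single j 1) (by
      constructor <;> intro i <;> by_cases hi : i = j
      · subst hi; simpa using h0
      · simpa [hi] using hx0 i
      · subst hi; simpa using h1
      · simpa [hi] using hx.2 i)
    have h3 := N.lagrangian_add_single U x y j s
    dsimp only at h2
    linarith
  -- A positive `x j` may be decreased inside the box, so the left derivative at the maximum is
  -- nonnegative.
  have hpos : ∀ j, 0 < x j → 0 ≤ N.marginal U x y j := by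
    intro j hj
    have hle := N.le_sourceFlow hx0 j
    refine (hderiv j (Icc (N.sourceFlow x (N.source j) - x j) (N.sourceFlow x (N.source j)))
      fun s hs => (by linarith : (0 : ℝ) ≤ _).trans hs.1).nonneg_of_isMaxOn_Icc
        (by linarith) fun s hs => ?_
    have h1 := hmax j (s - N.sourceFlow x (N.source j)) (by linarith [hs.1])
      (by linarith [hs.2, show x j ≤ max B 0 from hx.2 j])
    simpa using h1
  have hopt : ∀ k v, 0 ≤ v → v ≤ M →
      y k * (N.capacity k - N.linkFlow x k) ≤ v * (N.capacity k - N.linkFlow x k) := by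
    intro k v hv hvM
    have h1 := hxy (Function.update y k v) (by
      constructor <;> intro i <;> by_cases hi : i = k
      · subst hi; simpa using hv
      · simpa [hi] using hy0 i
      · subst hi; simpa using hvM
      · simpa [hi] using hy.2 i) x hx
    simp only [lagrangian, add_le_add_iff_left] at h1
    have h2 : ∑ i ∈ Finset.univ.erase k,
        Function.update y k v i * (N.capacity i - N.linkFlow x i) =
        ∑ i ∈ Finset.univ.erase k, y i * (N.capacity i - N.linkFlow x i) :=
      Finset.sum_congr rfl fun i hi => by
        rw [Function.update_of_ne (Finset.ne_of_mem_erase hi)]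
    rw [← Finset.add_sum_erase _ _ (Finset.mem_univ k),
      ← Finset.add_sum_erase _ _ (Finset.mem_univ k), Function.update_self, h2] at h1
    linarith
  have hflow : ∀ k, N.linkFlow x k - N.capacity k ≤ 0 := by
    intro k
    by_contra! hk
    -- An overloaded link drives its price to the ceiling. Some route with positive flow uses it and
    -- pays at least `M`, more than its marginal utility, against `hpos`.
    have hyM : M ≤ y k := by
      have := hopt k M hM0 le_rfl
      nlinarith
    obtain ⟨j, hj, hxj⟩ : ∃ j ∈ Finset.univ.filter (fun j => k ∈ N.links j), 0 < x j := by
      refine Finset.exists_lt_of_sum_lt (f := fun _ => (0 : ℝ)) ?_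
      have := hC k
      simp only [Finset.sum_const_zero]
      change 0 < N.linkFlow x k
      linarith
    have h1 := hpos j hxj
    have h2 := N.le_routePrice hy0 (Finset.mem_filter.1 hj).2
    have h3 := hanti (N.source j) _ (hq0 (N.source j))
    rw [marginal] at h1
    linarith
  have hneg : ∀ j, N.marginal U x y j ≤ 0 := by
    intro j
    obtain ⟨k, hk⟩ := hlinks j
    -- Some link of the route caps `x j` strictly below the box bound, so `x j` may be increased and
    -- the right derivative is nonpositive.
    have hjB : x j < max B 0 := by
      have := N.le_linkFlow hx0 hk
      have := hflow k
      have := hB k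
      exact lt_max_of_lt_left (by linarith)
    refine (hderiv j (Icc (N.sourceFlow x (N.source j))
      (N.sourceFlow x (N.source j) + (max B 0 - x j)))
      fun s hs => (hq0 _).trans hs.1).nonpos_of_isMaxOn_Icc (by linarith) fun s hs => ?_
    have h1 := hmax j (s - N.sourceFlow x (N.source j)) (by linarith [hs.1, hx0 j])
      (by linarith [hs.2])
    simpa using h1
  refine ⟨x, y, hx0, hy0, hneg, fun j => ?_, hflow, fun k => ?_⟩
  · rcases (hx0 j).eq_or_lt with h | h
    · rw [← h, zero_mul]
    · rw [le_antisymm (hneg j) (hpos j h), mul_zero]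
  · have h1 := hopt k 0 le_rfl hM0
    have h2 := mul_nonpos_of_nonneg_of_nonpos (hy0 k) (hflow k)
    linarith

end RoutingNetwork

/-! ### Energy decay, boundedness and `x - x' → 0` -/

/-- A Lipschitz function whose square is dominated by the decay rate of a nonnegative
antitone function vanishes at infinity. -/
theorem tendsto_zero_of_sq_le_decay {V u : ℝ → ℝ} {c K : ℝ} (hc : 0 < c) (hK : 0 < K)
    (hV : ∀ a b, 0 ≤ a → a ≤ b → AbsolutelyContinuousOnInterval V a b)
    (hV0 : ∀ t, 0 ≤ V t) (hVanti : AntitoneOn V (Ici 0))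
    (hd : ∀ᵐ t, 0 < t → ∃ d, HasDerivAt V d t ∧ d ≤ -(c * u t ^ 2))
    (hu : ∀ a b, 0 ≤ a → a ≤ b → |u b - u a| ≤ K * (b - a)) :
    Tendsto u atTop (𝓝 0) := by
  rw [Metric.tendsto_nhds]
  intro ε hε
  -- If `|u t| ≥ ε`, then `|u| ≥ ε/2` for time `δ`, during which `V` loses at least `η`. After a
  -- time `t₀` where `V` is within `η` of its infimum this is impossible.
  set δ := ε / (2 * K)
  have hδ : 0 < δ := by positivity
  have hKδ : K * δ = ε / 2 := by simp only [δ]; field_simp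
  set η := c * (ε / 2) ^ 2 * δ
  have hη : 0 < η := by positivity
  have hbdd : BddBelow (V '' Ici 0) := ⟨0, by rintro _ ⟨t, -, rfl⟩; exact hV0 t⟩
  obtain ⟨_, ⟨t₀, ht₀, rfl⟩, hlt⟩ := exists_lt_of_csInf_lt
    (⟨V 0, 0, self_mem_Ici, rfl⟩ : (V '' Ici 0).Nonempty)
    (lt_add_of_pos_right (sInf (V '' Ici 0)) hη)
  replace ht₀ : 0 ≤ t₀ := ht₀
  filter_upwards [eventually_ge_atTop t₀] with t ht
  by_contra! hge
  rw [Real.dist_eq, sub_zero] at hge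
  have h0t : 0 ≤ t := ht₀.trans ht
  have h1 := (hV t (t + δ) h0t (by linarith)).sub_le_mul_of_ae (c := -(c * (ε / 2) ^ 2))
    (by linarith) (by
      filter_upwards [hd] with s hs hmem
      obtain ⟨d, hd, hle⟩ := hs (h0t.trans_lt hmem.1)
      refine ⟨d, hd, hle.trans (neg_le_neg ?_)⟩
      have h2 := hu t s h0t hmem.1.le
      have h3 : K * (s - t) ≤ K * δ := by gcongr; linarith [hmem.2]
      have h4 : |u t| ≤ |u s| + |u s - u t| := by
        have := abs_sub_abs_le_abs_sub (u t) (u s)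
        rw [abs_sub_comm] at this
        linarith
      have h5 : ε / 2 ≤ |u s| := by linarith
      rw [← sq_abs (u s)]
      gcongr)
  have h2 : sInf (V '' Ici 0) ≤ V (t + δ) :=
    csInf_le hbdd ⟨t + δ, by simp only [mem_Ici]; linarith, rfl⟩
  have h3 : V t ≤ V t₀ := hVanti ht₀ h0t ht
  rw [add_sub_cancel_left, neg_mul] at h1
  change _ ≤ -η at h1
  linarith

namespace RoutingNetwork

variable {S R L : Type*} [Fintype S] [Fintype R] [Fintype L] [DecidableEq S] [DecidableEq L]

/-- Squared distance between the states `(x, x', y)` and `(xs, xs, ys)`. -/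
def energy (xs : R → ℝ) (ys : L → ℝ) (x x' : R → ℝ) (y : L → ℝ) : ℝ :=
  ∑ j, ((x j - xs j) ^ 2 + (x' j - xs j) ^ 2) + ∑ k, (y k - ys k) ^ 2

theorem energy_nonneg (xs : R → ℝ) (ys : L → ℝ) (x x' : R → ℝ) (y : L → ℝ) :
    0 ≤ energy xs ys x x' y := by
  unfold energy; positivity

theorem sq_sub_le_energy_left (xs : R → ℝ) (ys : L → ℝ) (x x' : R → ℝ) (y : L → ℝ) (j : R) :
    (x j - xs j) ^ 2 + (x' j - xs j) ^ 2 ≤ energy xs ys x x' y :=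
  (Finset.single_le_sum (f := fun j => (x j - xs j) ^ 2 + (x' j - xs j) ^ 2)
    (fun j _ => by positivity) (Finset.mem_univ j)).trans
    (le_add_of_nonneg_right (by positivity))

theorem sq_sub_le_energy_right (xs : R → ℝ) (ys : L → ℝ) (x x' : R → ℝ) (y : L → ℝ) (k : L) :
    (y k - ys k) ^ 2 ≤ energy xs ys x x' y :=
  (Finset.single_le_sum (f := fun k => (y k - ys k) ^ 2)
    (fun k _ => by positivity) (Finset.mem_univ k)).trans
    (le_add_of_nonneg_left (by positivity))

/-- After the projections are dropped, the `κ` terms combine to `-κ_j (x_j - x'_j)^2`. The gradient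
terms in `x` are at most `φ(x, y) - φ(xs, y)` by concavity and those in `y` at most `φ(x, ys) - φ(x,
y)`; their sum `φ(x, ys) - φ(xs, y)` is nonpositive at a saddle point. -/
theorem IsKKT.dissipation {N : RoutingNetwork S R L} {U : S → ℝ → ℝ} {xs : R → ℝ} {ys : L → ℝ}
    (h : N.IsKKT U xs ys) (hc : ∀ i, ConcaveOn ℝ (Ici 0) (U i))
    (hd : ∀ i, DifferentiableOn ℝ (U i) (Ici 0)) (κ : R → ℝ) {x : R → ℝ} (x' : R → ℝ) {y : L → ℝ}
    (hx : ∀ j, 0 ≤ x j) (hy : ∀ k, 0 ≤ y k) :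
    ∑ j, ((x j - xs j) * projRate (N.marginal U x y j + κ j * (x' j - x j)) (x j)
      + (x' j - xs j) * (κ j * (x j - x' j)))
      + ∑ k, (y k - ys k) * projRate (N.linkFlow x k - N.capacity k) (y k)
      ≤ -∑ j, κ j * (x j - x' j) ^ 2 := by
  have h1 : ∑ j, ((x j - xs j) * projRate (N.marginal U x y j + κ j * (x' j - x j)) (x j)
      + (x' j - xs j) * (κ j * (x j - x' j))) ≤
      -∑ j, N.marginal U x y j * (xs j - x j) - ∑ j, κ j * (x j - x' j) ^ 2 := by
    rw [← Finset.sum_neg_distrib, ← Finset.sum_sub_distrib]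
    refine Finset.sum_le_sum fun j _ => ?_
    have := sub_mul_projRate_le (a := N.marginal U x y j + κ j * (x' j - x j)) (hx j)
      (h.nonneg_x j)
    linarith
  have h2 : ∑ k, (y k - ys k) * projRate (N.linkFlow x k - N.capacity k) (y k) ≤
      N.lagrangian U x ys - N.lagrangian U x y := by
    simp only [lagrangian, add_sub_add_left_eq_sub]
    rw [← Finset.sum_sub_distrib]
    refine Finset.sum_le_sum fun k _ => ?_
    have := sub_mul_projRate_le (a := N.linkFlow x k - N.capacity k) (hy k) (h.nonneg_y k)
    linarith
  have h3 := lagrangian_sub_le (N := N) hc hd hx h.nonneg_x y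
  obtain ⟨-, h4, h5⟩ := h.isRestrictedSaddlePoint hc hd
  have h6 := h4 x ⟨hx, h.nonneg_y⟩
  have h7 := h5 y ⟨h.nonneg_x, hy⟩
  linarith

namespace IsModifiedSolution

variable {N : RoutingNetwork S R L} {U : S → ℝ → ℝ} {κ : R → ℝ} {x x' : ℝ → R → ℝ}
  {y : ℝ → L → ℝ} {xs : R → ℝ} {ys : L → ℝ}

theorem ac_energy (h : N.IsModifiedSolution U κ x x' y) (xs : R → ℝ) (ys : L → ℝ) {a b : ℝ}
    (ha : 0 ≤ a) (hab : a ≤ b) :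
    AbsolutelyContinuousOnInterval (fun t => energy xs ys (x t) (x' t) (y t)) a b := by
  have hb := ha.trans hab
  refine AbsolutelyContinuousOnInterval.mono (a := 0) (b := b) ?_ (by
    rw [uIcc_of_le hab, uIcc_of_le hb]; exact Icc_subset_Icc_left ha)
  refine AbsolutelyContinuousOnInterval.add
    (AbsolutelyContinuousOnInterval.finset_sum _ fun j _ => AbsolutelyContinuousOnInterval.add
      ((h.ac_x j b hb).sq_sub_const (xs j)) ((h.ac_x' j b hb).sq_sub_const (xs j)))
    (AbsolutelyContinuousOnInterval.finset_sum _ fun k _ => (h.ac_y k b hb).sq_sub_const (ys k))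

theorem hasDerivAt_energy_le (h : N.IsModifiedSolution U κ x x' y) (hs : N.IsKKT U xs ys)
    (hc : ∀ i, ConcaveOn ℝ (Ici 0) (U i)) (hd : ∀ i, DifferentiableOn ℝ (U i) (Ici 0)) :
    ∀ᵐ t, 0 < t → ∃ d, HasDerivAt (fun t => energy xs ys (x t) (x' t) (y t)) d t ∧
      d ≤ -(2 * ∑ j, κ j * (x t j - x' t j) ^ 2) := by
  filter_upwards [ae_all_iff.2 h.ode_x, ae_all_iff.2 h.ode_x', ae_all_iff.2 h.ode_y]
    with t h1 h2 h3 ht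
  obtain ⟨hx, hy⟩ := h.mem_domain t ht.le
  refine ⟨_, (HasDerivAt.fun_sum fun j _ => (((h1 j ht).sub_const (xs j)).fun_pow 2).fun_add
    (((h2 j ht).sub_const (xs j)).fun_pow 2)).fun_add
    (HasDerivAt.fun_sum fun k _ => ((h3 k ht).sub_const (ys k)).fun_pow 2), ?_⟩
  have h4 := hs.dissipation hc hd κ (x' t) hx hy
  simp only [marginal] at h4
  have h5 : ∀ a b c : ℝ, a + b ≤ -c → 2 * a + 2 * b ≤ -(2 * c) := fun a b c h => by linarith
  refine le_of_eq_of_le ?_ (h5 _ _ _ h4)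
  rw [Finset.mul_sum, Finset.mul_sum]
  congr 1 <;> refine Finset.sum_congr rfl fun _ _ => ?_ <;> push_cast <;> ring

theorem antitoneOn_energy (h : N.IsModifiedSolution U κ x x' y) (hs : N.IsKKT U xs ys)
    (hc : ∀ i, ConcaveOn ℝ (Ici 0) (U i)) (hd : ∀ i, DifferentiableOn ℝ (U i) (Ici 0))
    (hκ : ∀ j, 0 < κ j) : AntitoneOn (fun t => energy xs ys (x t) (x' t) (y t)) (Ici 0) := by
  intro a ha b _ hab
  have h1 := (h.ac_energy xs ys ha hab).sub_le_mul_of_ae (c := 0) hab (by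
    filter_upwards [h.hasDerivAt_energy_le hs hc hd] with t ht hmem
    obtain ⟨d, hd, hle⟩ := ht (lt_of_le_of_lt ha hmem.1)
    refine ⟨d, hd, hle.trans ?_⟩
    have : 0 ≤ ∑ j, κ j * (x t j - x' t j) ^ 2 :=
      Finset.sum_nonneg fun j _ => mul_nonneg (hκ j).le (sq_nonneg _)
    linarith)
  dsimp only at *
  linarith

theorem exists_bound (h : N.IsModifiedSolution U κ x x' y) (hs : N.IsKKT U xs ys)
    (hc : ∀ i, ConcaveOn ℝ (Ici 0) (U i)) (hd : ∀ i, DifferentiableOn ℝ (U i) (Ici 0))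
    (hκ : ∀ j, 0 < κ j) : ∃ B, 0 ≤ B ∧ ∀ t, 0 ≤ t →
      (∀ j, |x t j| ≤ B) ∧ (∀ j, |x' t j| ≤ B) ∧ ∀ k, |y t k| ≤ B := by
  set E := energy xs ys (x 0) (x' 0) (y 0)
  refine ⟨√E + (∑ j, |xs j| + ∑ k, |ys k|), by positivity, fun t ht => ?_⟩
  have hE : energy xs ys (x t) (x' t) (y t) ≤ E :=
    h.antitoneOn_energy hs hc hd hκ self_mem_Ici ht ht
  have key : ∀ a c : ℝ, (a - c) ^ 2 ≤ E → |c| ≤ ∑ j, |xs j| + ∑ k, |ys k| →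
      |a| ≤ √E + (∑ j, |xs j| + ∑ k, |ys k|) := by
    intro a c h1 h2
    have h3 := Real.abs_le_sqrt h1
    have h4 := abs_sub_abs_le_abs_sub a c
    linarith
  have hxs : ∀ j, |xs j| ≤ ∑ j, |xs j| + ∑ k, |ys k| := fun j =>
    (Finset.single_le_sum (f := fun j => |xs j|) (fun _ _ => abs_nonneg _)
      (Finset.mem_univ j)).trans (le_add_of_nonneg_right (by positivity))
  have hys : ∀ k, |ys k| ≤ ∑ j, |xs j| + ∑ k, |ys k| := fun k =>
    (Finset.single_le_sum (f := fun k => |ys k|) (fun _ _ => abs_nonneg _)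
      (Finset.mem_univ k)).trans (le_add_of_nonneg_left (by positivity))
  refine ⟨fun j => key _ (xs j) ?_ (hxs j), fun j => key _ (xs j) ?_ (hxs j),
    fun k => key _ (ys k) ?_ (hys k)⟩
  · have := sq_sub_le_energy_left xs ys (x t) (x' t) (y t) j
    linarith [sq_nonneg (x' t j - xs j)]
  · have := sq_sub_le_energy_left xs ys (x t) (x' t) (y t) j
    linarith [sq_nonneg (x t j - xs j)]
  · exact (sq_sub_le_energy_right xs ys (x t) (x' t) (y t) k).trans hE

theorem tendsto_sub_zero (h : N.IsModifiedSolution U κ x x' y) (hs : N.IsKKT U xs ys)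
    (hc : ∀ i, ConcaveOn ℝ (Ici 0) (U i)) (hd : ∀ i, DifferentiableOn ℝ (U i) (Ici 0))
    (hm : ∀ i, MonotoneOn (U i) (Ici 0))
    (hκ : ∀ j, 0 < κ j) (j : R) : Tendsto (fun t => x t j - x' t j) atTop (𝓝 0) := by
  obtain ⟨B, hB0, hB⟩ := h.exists_bound hs hc hd hκ
  set D := derivWithin (U (N.source j)) (Ici 0) 0
  -- Bounds the speed of `x_j - x'_j`: `D` for the marginal utility, which is nonnegative and
  -- largest at `0`, then the route price, then `2 κ_j B` from each of the two damping terms; `1`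
  -- makes it positive.
  set K := D + (N.links j).card * B + 4 * (κ j * B) + 1
  have hD : ∀ q, 0 ≤ q → |derivWithin (U (N.source j)) (Ici 0) q| ≤ D := by
    intro q hq
    rw [abs_of_nonneg ((hm _).derivWithin_nonneg)]
    exact (hc _).antitoneOn_derivWithin (hd _) self_mem_Ici hq hq
  have hD0 : 0 ≤ D := (abs_nonneg _).trans (hD 0 le_rfl)
  have hκB : 0 ≤ κ j * B := mul_nonneg (hκ j).le hB0
  have hK : 0 < K := by positivity
  refine tendsto_zero_of_sq_le_decay (c := 2 * κ j) (K := K) (by linarith [hκ j]) hK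
    (fun a b ha hab => h.ac_energy xs ys ha hab) (fun t => energy_nonneg _ _ _ _ _)
    (h.antitoneOn_energy hs hc hd hκ) ?_ ?_
  · filter_upwards [h.hasDerivAt_energy_le hs hc hd] with t ht ht0
    obtain ⟨d, hd, hle⟩ := ht ht0
    refine ⟨d, hd, hle.trans (neg_le_neg ?_)⟩
    rw [mul_assoc]
    have := Finset.single_le_sum (f := fun j => κ j * (x t j - x' t j) ^ 2)
      (fun j _ => mul_nonneg (hκ j).le (sq_nonneg _)) (Finset.mem_univ j)
    linarith
  · intro a b ha hab
    have hsub : AbsolutelyContinuousOnInterval (fun t => x t j - x' t j) a b :=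
      AbsolutelyContinuousOnInterval.mono (a := 0) (b := b)
        ((h.ac_x j b (ha.trans hab)).sub (h.ac_x' j b (ha.trans hab))) (by
          rw [uIcc_of_le hab, uIcc_of_le (ha.trans hab)]; exact Icc_subset_Icc_left ha)
    refine hsub.abs_sub_le_of_ae hab ?_
    filter_upwards [h.ode_x j, h.ode_x' j] with t h1 h2 hmem
    have ht : 0 < t := ha.trans_lt hmem.1
    refine ⟨_, (h1 ht).fun_sub (h2 ht), ?_⟩
    obtain ⟨b1, b2, b3⟩ := hB t ht.le
    have hdiff : |x t j - x' t j| ≤ 2 * B := by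
      have := abs_sub (x t j) (x' t j)
      linarith [b1 j, b2 j]
    have hκd : |κ j * (x t j - x' t j)| ≤ 2 * (κ j * B) := by
      rw [abs_mul, abs_of_pos (hκ j)]
      have := mul_le_mul_of_nonneg_left hdiff (hκ j).le
      linarith
    have hκd' : |κ j * (x' t j - x t j)| ≤ 2 * (κ j * B) := by
      rwa [← neg_sub, mul_neg, abs_neg]
    have hprice : |N.routePrice (y t) j| ≤ (N.links j).card * B := by
      refine (Finset.abs_sum_le_sum_abs _ _).trans ?_
      rw [← nsmul_eq_mul]
      exact Finset.sum_le_card_nsmul _ _ _ fun k _ => b3 k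
    have hU := hD _ (N.sourceFlow_nonneg (h.mem_domain t ht.le).1 (N.source j))
    refine (abs_sub _ _).trans ((add_le_add (abs_projRate_le _ _) hκd).trans ?_)
    have t1 := abs_add_le (derivWithin (U (N.source j)) (Ici 0) (N.sourceFlow (x t) (N.source j))
      - N.routePrice (y t) j) (κ j * (x' t j - x t j))
    have t2 := abs_sub (derivWithin (U (N.source j)) (Ici 0) (N.sourceFlow (x t) (N.source j)))
      (N.routePrice (y t) j)
    linarith

end IsModifiedSolution

end RoutingNetwork

/-! ### Limit points are KKT points, and convergence -/

namespace RoutingNetwork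

variable {S R L : Type*} [Fintype S] [Fintype R] [Fintype L] [DecidableEq S] [DecidableEq L]

namespace IsModifiedSolution

variable {N : RoutingNetwork S R L} {U : S → ℝ → ℝ} {κ : R → ℝ} {x x' : ℝ → R → ℝ}
  {y : ℝ → L → ℝ}

/-- Limits of a bounded solution along a filter `F ≤ atTop` satisfy the KKT conditions. -/
theorem isKKT_of_tendsto (h : N.IsModifiedSolution U κ x x' y)
    (hcont : ∀ i, ContinuousOn (derivWithin (U i) (Ici 0)) (Ici 0))
    (hsub : ∀ j, Tendsto (fun t => x t j - x' t j) atTop (𝓝 0))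
    {B : ℝ} (hB : ∀ t, 0 ≤ t → ∀ k, y t k ≤ B)
    {F : Filter ℝ} [F.NeBot] (hF : F ≤ atTop) {p : R → ℝ} {q : L → ℝ}
    (hp : ∀ j, Tendsto (fun t => x' t j) F (𝓝 (p j)))
    (hq : ∀ k, Tendsto (fun t => y t k) F (𝓝 (q k))) : N.IsKKT U p q := by
  have hwin : ∀ T, Tendsto (fun z : ℝ × ℝ => z.1 + z.2) (F ×ˢ 𝓟 (Icc (-T) T)) atTop := by
    intro T
    rw [tendsto_atTop]
    intro c
    rw [eventually_prod_principal_iff]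
    filter_upwards [hF (Ioi_mem_atTop (c + T))] with t ht s hs
    have : c + T < t := ht
    linarith [hs.1]
  have hx'w : ∀ T j, Tendsto (fun z : ℝ × ℝ => x' (z.1 + z.2) j) (F ×ˢ 𝓟 (Icc (-T) T))
      (𝓝 (p j)) := fun T j => by
    refine tendsto_window_of_tendsto_deriv_zero (f := fun t => x' t j) hF (h.ac_x' j)
      (h.ode_x' j) ?_ (hp j) T
    simpa using (hsub j).const_mul (κ j)
  have hxw : ∀ T, Tendsto (fun z : ℝ × ℝ => x (z.1 + z.2)) (F ×ˢ 𝓟 (Icc (-T) T)) (𝓝 p) :=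
    fun T => tendsto_pi_nhds.2 fun j => by
      simpa using ((hsub j).comp (hwin T)).add (hx'w T j)
  have hnnw : ∀ T, ∀ᶠ z in F ×ˢ 𝓟 (Icc (-T) T), 0 ≤ z.1 + z.2 := fun T =>
    (hwin T).eventually (eventually_ge_atTop 0)
  have hp0 : ∀ j, 0 ≤ p j := fun j => by
    have hxj : Tendsto (fun t => x t j) F (𝓝 (p j)) := by
      simpa using ((hsub j).mono_left hF).add (hp j)
    refine ge_of_tendsto hxj ?_
    filter_upwards [hF (Ici_mem_atTop (0 : ℝ))] with t ht using (h.mem_domain t ht).1 j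
  have hq0 : ∀ k, 0 ≤ q k := fun k => by
    refine ge_of_tendsto (hq k) ?_
    filter_upwards [hF (Ici_mem_atTop (0 : ℝ))] with t ht using (h.mem_domain t ht).2 k
  have hflow : ∀ k T, Tendsto (fun z : ℝ × ℝ => N.linkFlow (x (z.1 + z.2)) k - N.capacity k)
      (F ×ˢ 𝓟 (Icc (-T) T)) (𝓝 (N.linkFlow p k - N.capacity k)) := fun k T =>
    (((N.continuous_linkFlow k).tendsto p).comp (hxw T)).sub_const _
  -- The rate of `y` involves only `x`, whose window convergence is already known; the rate of `x`
  -- involves `y` and has to come after.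
  have hyw : ∀ k T, Tendsto (fun z : ℝ × ℝ => y (z.1 + z.2) k) (F ×ˢ 𝓟 (Icc (-T) T))
      (𝓝 (q k)) := fun k T =>
    tendsto_window_of_tendsto_rate (f := fun t => y t k)
      (g := fun t => N.linkFlow (x t) k - N.capacity k) hF (h.ac_y k) (h.ode_y k)
      (fun t ht => (h.mem_domain t ht).2 k) (fun t ht => hB t ht k) (hq k) (hflow k) T
  have hcy := fun k => complementary_of_tendsto_window (f := fun t => y t k)
    (g := fun t => N.linkFlow (x t) k - N.capacity k) hF (h.ac_y k) (h.ode_y k) (hq0 k)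
    (hyw k 1) (hflow k 1)
  have hmarg : ∀ j, Tendsto (fun z : ℝ × ℝ => N.marginal U (x (z.1 + z.2)) (y (z.1 + z.2)) j
      + κ j * (x' (z.1 + z.2) j - x (z.1 + z.2) j)) (F ×ˢ 𝓟 (Icc (-1) 1))
      (𝓝 (N.marginal U p q j)) := by
    intro j
    have h1 : Tendsto (fun z : ℝ × ℝ => N.sourceFlow (x (z.1 + z.2)) (N.source j))
        (F ×ˢ 𝓟 (Icc (-1) 1)) (𝓝[Ici 0] (N.sourceFlow p (N.source j))) := by
      refine tendsto_nhdsWithin_iff.2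
        ⟨((N.continuous_sourceFlow _).tendsto p).comp (hxw 1), ?_⟩
      filter_upwards [hnnw 1] with z hz using N.sourceFlow_nonneg (h.mem_domain _ hz).1 _
    have h2 : Tendsto (fun z : ℝ × ℝ => N.routePrice (y (z.1 + z.2)) j)
        (F ×ˢ 𝓟 (Icc (-1) 1)) (𝓝 (N.routePrice q j)) :=
      tendsto_finsetSum _ fun k _ => hyw k 1
    have h3 := ((hcont (N.source j) _ (N.sourceFlow_nonneg hp0 (N.source j))).tendsto.comp h1).sub h2
    have h4 := (((hsub j).comp (hwin 1)).neg).const_mul (κ j)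
    simpa [marginal] using h3.add h4
  have hcx := fun j => complementary_of_tendsto_window (f := fun t => x t j)
    (g := fun t => N.marginal U (x t) (y t) j + κ j * (x' t j - x t j)) hF (h.ac_x j)
    (h.ode_x j) (hp0 j) (tendsto_pi_nhds.1 (hxw 1) j) (hmarg j)
  exact ⟨hp0, hq0, fun j => (hcx j).1, fun j => (hcx j).2, fun k => (hcy k).1, fun k => (hcy k).2⟩

theorem exists_isKKT_tendsto (h : N.IsModifiedSolution U κ x x' y)
    (hC : ∀ k, 0 ≤ N.capacity k) (hlinks : ∀ j, (N.links j).Nonempty)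
    (hc : ∀ i, ConcaveOn ℝ (Ici 0) (U i)) (hd : ∀ i, DifferentiableOn ℝ (U i) (Ici 0))
    (hcont : ∀ i, ContinuousOn (derivWithin (U i) (Ici 0)) (Ici 0))
    (hm : ∀ i, MonotoneOn (U i) (Ici 0)) (hκ : ∀ j, 0 < κ j) :
    ∃ xs ys, N.IsKKT U xs ys ∧ Tendsto x atTop (𝓝 xs) ∧ Tendsto x' atTop (𝓝 xs) ∧
      Tendsto y atTop (𝓝 ys) := by
  obtain ⟨x₀, y₀, h₀⟩ := N.exists_isKKT hC hlinks hc hd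
  have hsub := h.tendsto_sub_zero h₀ hc hd hm hκ
  obtain ⟨B, -, hB⟩ := h.exists_bound h₀ hc hd hκ
  -- Every bounded coordinate converges along an ultrafilter, so no successive extraction of
  -- subsequences is needed.
  set F := Ultrafilter.of (atTop : Filter ℝ)
  have hF : (F : Filter ℝ) ≤ atTop := Ultrafilter.of_le _
  have hlim : ∀ f : ℝ → ℝ, (∀ t, 0 ≤ t → |f t| ≤ B) → ∃ a, Tendsto f F (𝓝 a) := by
    intro f hf
    obtain ⟨a, -, ha⟩ := (isCompact_Icc (a := -B) (b := B)).ultrafilter_le_nhds (F.map f) (by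
      rw [Ultrafilter.coe_map, le_principal_iff, mem_map]
      filter_upwards [hF (Ici_mem_atTop (0 : ℝ))] with t ht using abs_le.1 (hf t ht))
    exact ⟨a, ha⟩
  choose p hp using fun j => hlim (fun t => x' t j) fun t ht => (hB t ht).2.1 j
  choose q hq using fun k => hlim (fun t => y t k) fun t ht => (hB t ht).2.2 k
  have hK := h.isKKT_of_tendsto hcont hsub (fun t ht k => (abs_le.1 ((hB t ht).2.2 k)).2) hF hp hq
  have hpx : ∀ j, Tendsto (fun t => x t j) F (𝓝 (p j)) := fun j => by
    simpa using ((hsub j).mono_left hF).add (hp j)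
  have hEF : Tendsto (fun t => energy p q (x t) (x' t) (y t)) F (𝓝 0) := by
    have : Tendsto (fun t => energy p q (x t) (x' t) (y t)) F (𝓝 (energy p q p p q)) :=
      (tendsto_finsetSum _ fun j _ => (((hpx j).sub_const _).pow 2).add
        (((hp j).sub_const _).pow 2)).add
        (tendsto_finsetSum _ fun k _ => ((hq k).sub_const _).pow 2)
    simpa [energy] using this
  -- The limit `(p, q)` is itself a KKT point, so the energy centred there is antitone: being small
  -- at one time makes it small at all later times.
  have hE : Tendsto (fun t => energy p q (x t) (x' t) (y t)) atTop (𝓝 0) := by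
    rw [Metric.tendsto_nhds]
    intro ε hε
    obtain ⟨t₀, ht₀, ht₀'⟩ := ((Metric.tendsto_nhds.1 hEF ε hε).and
      (hF (Ici_mem_atTop (0 : ℝ)))).exists
    rw [Real.dist_0_eq_abs, abs_of_nonneg (energy_nonneg _ _ _ _ _)] at ht₀
    filter_upwards [eventually_ge_atTop t₀] with t ht
    rw [Real.dist_0_eq_abs, abs_of_nonneg (energy_nonneg _ _ _ _ _)]
    exact (h.antitoneOn_energy hK hc hd hκ ht₀' (le_trans ht₀' ht) ht).trans_lt ht₀
  have hsq : ∀ (f : ℝ → ℝ) (c : ℝ),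
      (∀ t, (f t - c) ^ 2 ≤ energy p q (x t) (x' t) (y t)) → Tendsto f atTop (𝓝 c) := by
    intro f c hf
    have h1 := squeeze_zero (fun t => sq_nonneg (f t - c)) hf hE
    have h2 : Tendsto (fun t => |f t - c|) atTop (𝓝 0) := by
      simpa [Real.sqrt_sq_eq_abs] using h1.sqrt
    exact tendsto_iff_dist_tendsto_zero.2 h2
  refine ⟨p, q, hK, tendsto_pi_nhds.2 fun j => hsq _ _ fun t => ?_,
    tendsto_pi_nhds.2 fun j => hsq _ _ fun t => ?_,
    tendsto_pi_nhds.2 fun k => hsq _ _ fun t => sq_sub_le_energy_right p q _ _ _ k⟩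
  · have := sq_sub_le_energy_left p q (x t) (x' t) (y t) j
    linarith [sq_nonneg (x' t j - p j)]
  · have := sq_sub_le_energy_left p q (x t) (x' t) (y t) j
    linarith [sq_nonneg (x t j - p j)]

end IsModifiedSolution

end RoutingNetwork

theorem mainTheorem10 {S R L : Type*} [Fintype S] [Fintype R] [Fintype L]
    [DecidableEq S] [DecidableEq L]
    (N : RoutingNetwork S R L)
    (hC : ∀ k, 0 ≤ N.capacity k)
    (hlinks : ∀ j, (N.links j).Nonempty)
    (U : S → ℝ → ℝ)
    (hU_smooth : ∀ i, ContDiffOn ℝ 2 (U i) (Ici 0))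
    (hU_concave : ∀ i, StrictConcaveOn ℝ (Ici 0) (U i))
    (hU_mono : ∀ i, StrictMonoOn (U i) (Ici 0))
    (κ : R → ℝ) (hκ : ∀ j, 0 < κ j)
    (x x' : ℝ → R → ℝ) (y : ℝ → L → ℝ)
    (hsol : N.IsModifiedSolution U κ x x' y) :
    ∃ (xs : R → ℝ) (ys : L → ℝ),
      N.IsOptimal U xs ∧
      IsRestrictedSaddlePoint (RoutingNetwork.orthant R L) (N.lagrangian U) xs ys ∧
      Tendsto x atTop (𝓝 xs) ∧ Tendsto x' atTop (𝓝 xs) ∧ Tendsto y atTop (𝓝 ys) := by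
  have hc := fun i => (hU_concave i).concaveOn
  have hd := fun i => (hU_smooth i).differentiableOn (by norm_num)
  obtain ⟨xs, ys, h, hlim⟩ := hsol.exists_isKKT_tendsto hC hlinks hc hd
    (fun i => (hU_smooth i).continuousOn_derivWithin (uniqueDiffOn_Ici 0) (by norm_num))
    (fun i => (hU_mono i).monotoneOn) hκ
  exact ⟨xs, ys, h.isOptimal hc hd, h.isRestrictedSaddlePoint hc hd, hlim⟩
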